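/- Let $(M_1,g_1)$ and $(M_2,g_2)$ be smooth, complete, connected Riemannian manifolds of finite dimension, with Riemannian distances $d_1,d_2$, and let $M=M_1\times M_2$ carry the product metric $g_1+g_2$ and the product distance $$d\big((x,y),(\bar x,\bar y)\big)=\sqrt{d_1(x,\bar x)^2+d_2(y,\bar y)^2}.$$ Let $\mathcal U_1\subset M_1$ and $\mathcal U_2\subset M_2$ be open and geodesically convex (any two points of the set are joined by a unique minimizing geodesic of the manifold, and this geodesic lies in the set), and put $\mathcal U=\mathcal U_1\times\mathcal U_2$. For two points $p,q$ of such a set, $\log_p q$ denotes the Riemannian logarithm, i.e. $\gamma'(0)$ for the minimizing geodesic $\gamma:[0,1]\to M$ from $p$ to $q$. For initial data $x_i^0\in M_1$, $y_i^0\in M_2$, $z_i^0=(x_i^0,y_i^0)$, $i=1,\dots,n$, consider the discrete systems with quadratic potential $K=\tfrac12(\text{distance})^2$, $$z_i'(t)=\frac1n\sum_{j=1}^n\log_{z_i(t)}z_j(t),\qquad z_i(0)=z_i^0,\tag{1}$$ $$x_i'(t)=\frac1n\sum_{j=1}^n\log_{x_i(t)}x_j(t),\quad x_i(0)=x_i^0,\qquad\qquad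 y_i'(t)=\frac1n\sum_{j=1}^n\log_{y_i(t)}y_j(t),\quad y_i(0)=y_i^0,\tag{2}$$ whose solutions are required to stay in $\mathcal U$, $\mathcal U_1$ and $\mathcal U_2$, respectively; in (1), $\log$ is the Riemannian logarithm of $(M,g_1+g_2)$. 1. (Decoupling.) For every $T\in(0,\infty]$, $(z_i)_{i=1}^n=((x_i,y_i))_{i=1}^n$ is a solution to (1) in $\mathcal U$ on $[0,T)$ if and only if $(x_i)_{i=1}^n$ and $(y_i)_{i=1}^n$ are solutions to the two systems (2) in $\mathcal U_1$ and $\mathcal U_2$ on $[0,T)$. 2. (Consensus.) Suppose that the two systems (2) have unique global solutions $(x_i)_{i=1}^n$ and $(y_i)_{i=1}^n$ in $\mathcal U_1$ and $\mathcal U_2$, respectively, and that for every $i,j\in\{1,\dots,n\}$ $$d_1(x_i(t),x_j(t))\to0\quad\text{and}\quad d_2(y_i(t),y_j(t))\to0\qquad\text{as }t\to\infty.$$ Then $(z_i)_{i=1}^n:=((x_i,y_i))_{i=1}^n$ is the unique global solution to (1) in $\mathcal U$, and for every $i,j\in\{1,\dots,n\}$ $$d(z_i(t),z_j(t))\to0\qquad\text{as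 }t\to\infty.$$ -/

import Mathlib

open Set Filter Topology Manifold Bundle
open scoped ContDiff ENNReal

noncomputable section

section ProductMetric

/-- The metric `g₁ + g₂` on the product of two manifolds with Riemannian metrics `g₁`, `g₂`:
`(g₁ + g₂)_(x, y) ((v, w), (v', w')) = (g₁)_x (v, v') + (g₂)_y (w, w')`. -/
def productMetric
    {E₁ : Type*} [NormedAddCommGroup E₁] [NormedSpace ℝ E₁]
    {H₁ : Type*} [TopologicalSpace H₁] {I₁ : ModelWithCorners ℝ E₁ H₁}
    {M₁ : Type*} [TopologicalSpace M₁] [ChartedSpace H₁ M₁]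
    {E₂ : Type*} [NormedAddCommGroup E₂] [NormedSpace ℝ E₂]
    {H₂ : Type*} [TopologicalSpace H₂] {I₂ : ModelWithCorners ℝ E₂ H₂}
    {M₂ : Type*} [TopologicalSpace M₂] [ChartedSpace H₂ M₂]
    (g₁ : RiemannianMetric (fun x : M₁ => TangentSpace I₁ x))
    (g₂ : RiemannianMetric (fun y : M₂ => TangentSpace I₂ y)) :
    RiemannianMetric (fun p : M₁ × M₂ => TangentSpace (I₁.prod I₂) p) where
  inner p :=
    let A : E₁ →L[ℝ] E₁ →L[ℝ] ℝ := g₁.inner p.1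
    let B : E₂ →L[ℝ] E₂ →L[ℝ] ℝ := g₂.inner p.2
    (A.bilinearComp (ContinuousLinearMap.fst ℝ E₁ E₂) (ContinuousLinearMap.fst ℝ E₁ E₂) +
      B.bilinearComp (ContinuousLinearMap.snd ℝ E₁ E₂) (ContinuousLinearMap.snd ℝ E₁ E₂) :
      E₁ × E₂ →L[ℝ] E₁ × E₂ →L[ℝ] ℝ)
  symm p v w := by
    exact congrArg₂ (· + ·) (g₁.symm p.1 v.1 w.1) (g₂.symm p.2 v.2 w.2)
  pos p v hv := by
    have h1 : 0 ≤ g₁.inner p.1 v.1 v.1 := by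
      by_cases h : v.1 = 0
      · rw [h]; exact (map_zero _).ge
      · exact (g₁.pos p.1 v.1 h).le
    have h2 : 0 ≤ g₂.inner p.2 v.2 v.2 := by
      by_cases h : v.2 = 0
      · rw [h]; exact (map_zero _).ge
      · exact (g₂.pos p.2 v.2 h).le
    by_cases h : v.1 = 0
    · have h' : v.2 ≠ 0 := fun h' => hv (Prod.ext h h')
      exact add_pos_of_nonneg_of_pos h1 (g₂.pos p.2 v.2 h')
    · exact add_pos_of_pos_of_nonneg (g₁.pos p.1 v.1 h) h2
  continuousAt p := by
    have h1 : ContinuousAt (fun v : E₁ × E₂ => (g₁.inner p.1 v.1 v.1 : ℝ)) 0 :=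
      ContinuousAt.comp (f := fun v : E₁ × E₂ => v.1) (g := fun v : E₁ => g₁.inner p.1 v v)
        (g₁.continuousAt p.1) continuousAt_fst
    have h2 : ContinuousAt (fun v : E₁ × E₂ => (g₂.inner p.2 v.2 v.2 : ℝ)) 0 :=
      ContinuousAt.comp (f := fun v : E₁ × E₂ => v.2) (g := fun v : E₂ => g₂.inner p.2 v v)
        (g₂.continuousAt p.2) continuousAt_snd
    exact h1.add h2
  isVonNBounded p := by
    have n1 : ∀ v : E₁, 0 ≤ g₁.inner p.1 v v := fun v => by
      by_cases h : v = 0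
      · rw [h]; exact (map_zero _).ge
      · exact (g₁.pos p.1 v h).le
    have n2 : ∀ v : E₂, 0 ≤ g₂.inner p.2 v v := fun v => by
      by_cases h : v = 0
      · rw [h]; exact (map_zero _).ge
      · exact (g₂.pos p.2 v h).le
    have h1 : Bornology.IsVonNBounded ℝ {v : E₁ | g₁.inner p.1 v v < 1} := g₁.isVonNBounded p.1
    have h2 : Bornology.IsVonNBounded ℝ {v : E₂ | g₂.inner p.2 v v < 1} := g₂.isVonNBounded p.2
    have h3 : Bornology.IsVonNBounded ℝ
        {v : E₁ × E₂ | g₁.inner p.1 v.1 v.1 + g₂.inner p.2 v.2 v.2 < 1} := by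
      rw [NormedSpace.isVonNBounded_iff] at h1 h2 ⊢
      refine (h1.prod h2).subset fun v hv => ?_
      have a1 := n1 v.1
      have a2 := n2 v.2
      have hv' : g₁.inner p.1 v.1 v.1 + g₂.inner p.2 v.2 v.2 < 1 := hv
      refine ⟨?_, ?_⟩
      · show g₁.inner p.1 v.1 v.1 < 1
        linarith
      · show g₂.inner p.2 v.2 v.2 < 1
        linarith
    exact h3

/-- The product of two manifolds with Riemannian metrics carries the product metric. -/
instance productRiemannianBundle
    {E₁ : Type*} [NormedAddCommGroup E₁] [NormedSpace ℝ E₁]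
    {H₁ : Type*} [TopologicalSpace H₁] {I₁ : ModelWithCorners ℝ E₁ H₁}
    {M₁ : Type*} [TopologicalSpace M₁] [ChartedSpace H₁ M₁]
    {E₂ : Type*} [NormedAddCommGroup E₂] [NormedSpace ℝ E₂]
    {H₂ : Type*} [TopologicalSpace H₂] {I₂ : ModelWithCorners ℝ E₂ H₂}
    {M₂ : Type*} [TopologicalSpace M₂] [ChartedSpace H₂ M₂]
    [h₁ : RiemannianBundle (fun x : M₁ => TangentSpace I₁ x)]
    [h₂ : RiemannianBundle (fun y : M₂ => TangentSpace I₂ y)] :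
    RiemannianBundle (fun p : M₁ × M₂ => TangentSpace (I₁.prod I₂) p) :=
  ⟨productMetric h₁.g h₂.g⟩

/-- The product distance `√(d₁(x, x̄)² + d₂(y, ȳ)²)`. (The `dist` that Mathlib puts on a product
of metric spaces is the maximum of the two distances and is not used.) -/
def productDist {M₁ M₂ : Type*} [Dist M₁] [Dist M₂] (z w : M₁ × M₂) : ℝ :=
  √(dist z.1 w.1 ^ 2 + dist z.2 w.2 ^ 2)

end ProductMetric

section Geodesics

variable {E : Type*} [NormedAddCommGroup E] [NormedSpace ℝ E]
  {H : Type*} [TopologicalSpace H] (I : ModelWithCorners ℝ E H)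
  {M : Type*} [TopologicalSpace M] [ChartedSpace H M]

/-- The velocity `γ'(t)` of a curve `γ : [0, 1] → M` (one-sided at the endpoints). -/
def velocity (γ : ℝ → M) (t : ℝ) : TangentSpace I (γ t) :=
  mfderivWithin 𝓘(ℝ, ℝ) I γ (Icc 0 1) t (1 : ℝ)

variable [RiemannianBundle (fun x : M => TangentSpace I x)]

/-- `γ : [0, 1] → M` is a minimizing geodesic from `x` to `y`: a smooth curve of constant speed
that joins `x` to `y` and whose length is the Riemannian distance from `x` to `y` (the infimum of
the lengths of all `C¹` curves from `x` to `y`). Values of `γ` outside `[0, 1]` are irrelevant. -/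
structure IsMinimizingGeodesic (γ : ℝ → M) (x y : M) : Prop where
  smooth : ContMDiffOn 𝓘(ℝ, ℝ) I ∞ γ (Icc 0 1)
  source : γ 0 = x
  target : γ 1 = y
  constant_speed : ∀ t ∈ Icc (0 : ℝ) 1, ‖velocity I γ t‖ = ‖velocity I γ 0‖
  minimizing : pathELength I γ 0 1 = riemannianEDist I x y

/-- `U` is geodesically convex: any two points of `U` are joined by a unique minimizing geodesic
of `M`, and this geodesic lies in `U`. -/
def IsGeodesicallyConvex (U : Set M) : Prop :=
  ∀ x ∈ U, ∀ y ∈ U, ∃ γ : ℝ → M, IsMinimizingGeodesic I γ x y ∧ MapsTo γ (Icc 0 1) U ∧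
    ∀ γ' : ℝ → M, IsMinimizingGeodesic I γ' x y → EqOn γ' γ (Icc 0 1)

open Classical in
/-- The Riemannian logarithm `log_x y`: the initial velocity `γ'(0)` of the minimizing geodesic `γ`
with `γ(0) = x`, `γ(1) = y`, i.e. the tangent vector at `x` which the exponential map sends to `y`
along that geodesic. If there is no minimizing geodesic the value is `0`; if there are several, one
of them is selected. Neither happens for two points of a geodesically convex set. -/
def riemannianLog (x y : M) : TangentSpace I x :=
  if h : ∃ γ : ℝ → M, IsMinimizingGeodesic I γ x y then
    (show E from velocity I h.choose 0)
  else 0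

/-- The time interval `[0, T)`, for `T ∈ (0, ∞]`. -/
def timeInterval (T : EReal) : Set ℝ := {t : ℝ | 0 ≤ t ∧ (t : EReal) < T}

/-- `x = (x_i)` is a solution in `U`, on `[0, T)`, of the discrete model with quadratic potential
`K = d² / 2`, that is, of `x_i' = (1/n) ∑_j log_{x_i} x_j`, `x_i(0) = x_i⁰`. -/
structure IsDiscreteSolution (U : Set M) {n : ℕ} (T : EReal) (x₀ : Fin n → M)
    (x : Fin n → ℝ → M) : Prop where
  mem : ∀ i, ∀ t ∈ timeInterval T, x i t ∈ U
  initial : ∀ i, x i 0 = x₀ i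
  deriv : ∀ i, ∀ t ∈ timeInterval T,
    HasMFDerivWithinAt 𝓘(ℝ, ℝ) I (x i) (timeInterval T) t
      ((1 : ℝ →L[ℝ] ℝ).smulRight ((1 / (n : ℝ)) • ∑ j, riemannianLog I (x i t) (x j t)))

/-- `x` is the unique global solution in `U` of the discrete model with initial data `x₀`. -/
def IsUniqueGlobalSolution (U : Set M) {n : ℕ} (x₀ : Fin n → M) (x : Fin n → ℝ → M) : Prop :=
  IsDiscreteSolution I U ⊤ x₀ x ∧
    ∀ x' : Fin n → ℝ → M, IsDiscreteSolution I U ⊤ x₀ x' → ∀ i, ∀ t : ℝ, 0 ≤ t → x' i t = x i t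

end Geodesics

end

/-! Everything reduces to `log_(x,y) (x',y') = (log_x x', log_y y')`. Given this, the right-hand
side of the product system is the pair of the two right-hand sides, and a curve in a product is
differentiated componentwise, so the systems decouple.

The logarithm splits because minimizing geodesics do, in both directions
(`IsMinimizingGeodesic.prodMk`, `IsMinimizingGeodesic.of_prodMk`). Let `a`, `b` be the distances of
the endpoints in the factors and `c = √(a² + b²)`. If the components of a curve have speeds `f`,
`g`, Cauchy–Schwarz gives `a f + b g ≤ c √(f² + g²)`. The left side integrates to at least `a² + b²
= c²`, so the length is at least `c`, and a pair of minimizing geodesics attains it. For a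
minimizing geodesic of the product, equality holds at every time, which forces `f = a` and `g = b`.
Neither the geodesic equation nor the exponential map is needed. -/

open MeasureTheory

/-! ### Speed and length of curves. -/

section Curves

variable {E : Type*} [NormedAddCommGroup E] [NormedSpace ℝ E]
  {H : Type*} [TopologicalSpace H] {I : ModelWithCorners ℝ E H}
  {M : Type*} [TopologicalSpace M] [ChartedSpace H M]

theorem velocity_congr {γ γ' : ℝ → M} (h : EqOn γ γ' (Icc 0 1)) {t : ℝ} (ht : t ∈ Icc (0 : ℝ) 1) :
    (show E from velocity I γ t) = (show E from velocity I γ' t) := by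
  have h' := mfderivWithin_congr (I := 𝓘(ℝ, ℝ)) (I' := I) h (h ht)
  exact congrArg (fun L : ℝ →L[ℝ] E => L 1) h'

variable [RiemannianBundle (fun x : M => TangentSpace I x)]

theorem pathELength_eq_lintegral_velocity (γ : ℝ → M) :
    pathELength I γ 0 1 = ∫⁻ t in Icc (0 : ℝ) 1, ‖velocity I γ t‖ₑ :=
  pathELength_eq_lintegral_mfderivWithin_Icc

/-- The length of a curve with continuous speed is the integral of its speed. -/
theorem pathELength_eq_ofReal_integral {γ : ℝ → M}
    (hγ : ContinuousOn (fun t => ‖velocity I γ t‖) (Icc 0 1)) :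
    pathELength I γ 0 1 = ENNReal.ofReal (∫ t in Icc (0 : ℝ) 1, ‖velocity I γ t‖) := by
  rw [pathELength_eq_lintegral_velocity, ofReal_integral_eq_lintegral_ofReal
    (hγ.integrableOn_compact isCompact_Icc) (ae_of_all _ fun _ => norm_nonneg _)]
  simp only [ofReal_norm]

theorem IsMinimizingGeodesic.contMDiffOn_one {γ : ℝ → M} {x y : M}
    (h : IsMinimizingGeodesic I γ x y) : ContMDiffOn 𝓘(ℝ, ℝ) I 1 γ (Icc 0 1) :=
  h.smooth.of_le (by exact_mod_cast le_top)

/-- The length of a constant-speed curve over a unit interval is its speed. In particular the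
distance is finite, so `toReal` loses nothing. -/
theorem IsMinimizingGeodesic.riemannianEDist_eq {γ : ℝ → M} {x y : M}
    (h : IsMinimizingGeodesic I γ x y) :
    riemannianEDist I x y = ENNReal.ofReal ‖velocity I γ 0‖ := by
  have hc : ContinuousOn (fun t => ‖velocity I γ t‖) (Icc 0 1) :=
    continuousOn_const.congr h.constant_speed
  rw [← h.minimizing, pathELength_eq_ofReal_integral hc,
    setIntegral_congr_fun measurableSet_Icc h.constant_speed]
  simp

variable [IsManifold I 1 M]
  [IsContinuousRiemannianBundle E (fun x : M => TangentSpace I x)]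

/-- The speed of a `C¹` curve is continuous. -/
theorem ContMDiffOn.continuousOn_norm_velocity {γ : ℝ → M}
    (hγ : ContMDiffOn 𝓘(ℝ, ℝ) I 1 γ (Icc 0 1)) :
    ContinuousOn (fun t => ‖velocity I γ t‖) (Icc 0 1) := by
  -- The velocity is the tangent map applied to the unit field `t ↦ (t, 1)`, hence continuous into
  -- the tangent bundle.
  have h1 := hγ.continuousOn_tangentMapWithin le_rfl (uniqueDiffOn_Icc zero_lt_one).uniqueMDiffOn
  have h2 : Continuous (fun t : ℝ => (⟨t, (1 : ℝ)⟩ : TangentBundle 𝓘(ℝ, ℝ) ℝ)) := by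
    rw [continuous_iff_continuousAt]
    intro t
    rw [FiberBundle.continuousAt_totalSpace]
    refine ⟨continuousAt_id, ?_⟩
    simpa using continuousAt_const
  have h3 : ContinuousOn (fun t => (⟨γ t, velocity I γ t⟩ : TangentBundle I M)) (Icc 0 1) :=
    h1.comp h2.continuousOn (fun t ht => ht)
  have h4 := ContinuousOn.inner_bundle (F := E) (E := fun x : M => TangentSpace I x) h3 h3
  refine (h4.sqrt).congr fun t _ => ?_
  exact norm_eq_sqrt_real_inner (velocity I γ t)

/-- The Riemannian distance is at most the integral of the speed of a `C¹` curve. -/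
theorem riemannianEDist_toReal_le_integral {γ : ℝ → M} {x y : M}
    (hγ : ContMDiffOn 𝓘(ℝ, ℝ) I 1 γ (Icc 0 1)) (h0 : γ 0 = x) (h1 : γ 1 = y) :
    (riemannianEDist I x y).toReal ≤ ∫ t in Icc (0 : ℝ) 1, ‖velocity I γ t‖ := by
  have h := riemannianEDist_le_pathELength hγ h0 h1 zero_le_one
  rw [pathELength_eq_ofReal_integral hγ.continuousOn_norm_velocity] at h
  exact ENNReal.toReal_le_of_le_ofReal (integral_nonneg fun _ => norm_nonneg _) h

end Curves

/-! ### Curves in a product. -/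

section Product

variable {E₁ : Type*} [NormedAddCommGroup E₁] [NormedSpace ℝ E₁]
  {H₁ : Type*} [TopologicalSpace H₁] {I₁ : ModelWithCorners ℝ E₁ H₁}
  {M₁ : Type*} [TopologicalSpace M₁] [ChartedSpace H₁ M₁]
  {E₂ : Type*} [NormedAddCommGroup E₂] [NormedSpace ℝ E₂]
  {H₂ : Type*} [TopologicalSpace H₂] {I₂ : ModelWithCorners ℝ E₂ H₂}
  {M₂ : Type*} [TopologicalSpace M₂] [ChartedSpace H₂ M₂]

theorem contMDiffOn_prodMk_iff {n : ℕ∞ω} {α : ℝ → M₁} {β : ℝ → M₂} {s : Set ℝ} :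
    ContMDiffOn 𝓘(ℝ, ℝ) (I₁.prod I₂) n (fun t => (α t, β t)) s ↔
      ContMDiffOn 𝓘(ℝ, ℝ) I₁ n α s ∧ ContMDiffOn 𝓘(ℝ, ℝ) I₂ n β s :=
  ⟨fun h => ⟨contMDiff_fst.comp_contMDiffOn h, contMDiff_snd.comp_contMDiffOn h⟩,
    fun h => h.1.prodMk h.2⟩

theorem hasMFDerivWithinAt_prodMk_iff {α : ℝ → M₁} {β : ℝ → M₂} {s : Set ℝ} {t : ℝ}
    {v : E₁} {w : E₂} :
    HasMFDerivWithinAt 𝓘(ℝ, ℝ) (I₁.prod I₂) (fun t => (α t, β t)) s t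
        ((1 : ℝ →L[ℝ] ℝ).smulRight ((v, w) : E₁ × E₂)) ↔
      HasMFDerivWithinAt 𝓘(ℝ, ℝ) I₁ α s t ((1 : ℝ →L[ℝ] ℝ).smulRight v) ∧
        HasMFDerivWithinAt 𝓘(ℝ, ℝ) I₂ β s t ((1 : ℝ →L[ℝ] ℝ).smulRight w) := by
  constructor
  · intro h
    exact ⟨(hasMFDerivAt_fst (α t, β t)).comp_hasMFDerivWithinAt t h,
      (hasMFDerivAt_snd (α t, β t)).comp_hasMFDerivWithinAt t h⟩
  · intro h
    exact h.1.prodMk h.2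

theorem velocity_prodMk {α : ℝ → M₁} {β : ℝ → M₂} {t : ℝ}
    (ht : t ∈ Icc (0 : ℝ) 1) (hα : MDifferentiableWithinAt 𝓘(ℝ, ℝ) I₁ α (Icc 0 1) t)
    (hβ : MDifferentiableWithinAt 𝓘(ℝ, ℝ) I₂ β (Icc 0 1) t) :
    (show E₁ × E₂ from velocity (I₁.prod I₂) (fun t => (α t, β t)) t) =
      (show E₁ from velocity I₁ α t, show E₂ from velocity I₂ β t) :=
  congrArg (fun L : ℝ →L[ℝ] E₁ × E₂ => L 1) (mfderivWithin_prodMk hα hβ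
    ((uniqueDiffOn_Icc zero_lt_one).uniqueMDiffOn t ht))

variable [RiemannianBundle (fun x : M₁ => TangentSpace I₁ x)]
  [RiemannianBundle (fun y : M₂ => TangentSpace I₂ y)]

theorem norm_sq_eq_add_of_productMetric {p : M₁ × M₂} (v : TangentSpace (I₁.prod I₂) p) :
    ‖v‖ ^ 2 = ‖(show TangentSpace I₁ p.1 from v.1)‖ ^ 2 +
      ‖(show TangentSpace I₂ p.2 from v.2)‖ ^ 2 := by
  rw [← real_inner_self_eq_norm_sq, ← real_inner_self_eq_norm_sq, ← real_inner_self_eq_norm_sq]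
  rfl

theorem norm_velocity_prodMk_sq {α : ℝ → M₁} {β : ℝ → M₂} {t : ℝ}
    (ht : t ∈ Icc (0 : ℝ) 1) (hα : MDifferentiableWithinAt 𝓘(ℝ, ℝ) I₁ α (Icc 0 1) t)
    (hβ : MDifferentiableWithinAt 𝓘(ℝ, ℝ) I₂ β (Icc 0 1) t) :
    ‖velocity (I₁.prod I₂) (fun t => (α t, β t)) t‖ ^ 2 =
      ‖velocity I₁ α t‖ ^ 2 + ‖velocity I₂ β t‖ ^ 2 := by
  rw [norm_sq_eq_add_of_productMetric]
  have h := velocity_prodMk ht hα hβ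
  rw [Prod.ext_iff] at h
  congr 3
  · exact h.1
  · exact h.2

theorem ContMDiffOn.norm_velocity_prodMk_sq {α : ℝ → M₁} {β : ℝ → M₂}
    (hα : ContMDiffOn 𝓘(ℝ, ℝ) I₁ 1 α (Icc 0 1)) (hβ : ContMDiffOn 𝓘(ℝ, ℝ) I₂ 1 β (Icc 0 1)) {t : ℝ}
    (ht : t ∈ Icc (0 : ℝ) 1) :
    ‖velocity (I₁.prod I₂) (fun t => (α t, β t)) t‖ ^ 2 =
      ‖velocity I₁ α t‖ ^ 2 + ‖velocity I₂ β t‖ ^ 2 :=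
  _root_.norm_velocity_prodMk_sq ht (hα.mdifferentiableOn one_ne_zero t ht)
    (hβ.mdifferentiableOn one_ne_zero t ht)

end Product

/-! ### Minimizing geodesics of the product metric. -/

section ProductGeodesics

/-- Cauchy–Schwarz in the plane; the defect of the squares is `(a g - b f)²`. -/
theorem mul_add_mul_le_of_sq_add_sq {a b c f g s : ℝ} (hc : 0 ≤ c) (hs : 0 ≤ s)
    (hab : c ^ 2 = a ^ 2 + b ^ 2) (hfg : s ^ 2 = f ^ 2 + g ^ 2) : a * f + b * g ≤ c * s := by
  refine le_of_sq_le_sq ?_ (mul_nonneg hc hs)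
  nlinarith [sq_nonneg (a * g - b * f), mul_pow c s 2]

/-- A continuous function on `[0, 1]` that is bounded above by a constant equals this constant if
its integral does. -/
theorem eqOn_const_of_le_integral {f : ℝ → ℝ} {c : ℝ} (hf : ContinuousOn f (Icc 0 1))
    (hle : ∀ t ∈ Icc (0 : ℝ) 1, f t ≤ c) (hint : c ≤ ∫ t in Icc (0 : ℝ) 1, f t) :
    ∀ t ∈ Icc (0 : ℝ) 1, f t = c := by
  intro t ht
  by_contra hne
  have h := intervalIntegral.integral_lt_integral_of_continuousOn_of_le_of_exists_lt
    (zero_lt_one (α := ℝ)) hf continuousOn_const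
    (fun s hs => hle s (Ioc_subset_Icc_self hs)) ⟨t, ht, lt_of_le_of_ne (hle t ht) hne⟩
  rw [intervalIntegral.integral_of_le zero_le_one, ← integral_Icc_eq_integral_Ioc,
    intervalIntegral.integral_const] at h
  simp at h
  exact absurd hint (not_le.mpr h)

variable {E₁ : Type*} [NormedAddCommGroup E₁] [NormedSpace ℝ E₁]
  {H₁ : Type*} [TopologicalSpace H₁] {I₁ : ModelWithCorners ℝ E₁ H₁}
  {M₁ : Type*} [TopologicalSpace M₁] [ChartedSpace H₁ M₁]
  {E₂ : Type*} [NormedAddCommGroup E₂] [NormedSpace ℝ E₂]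
  {H₂ : Type*} [TopologicalSpace H₂] {I₂ : ModelWithCorners ℝ E₂ H₂}
  {M₂ : Type*} [TopologicalSpace M₂] [ChartedSpace H₂ M₂]
  [RiemannianBundle (fun x : M₁ => TangentSpace I₁ x)]
  [RiemannianBundle (fun y : M₂ => TangentSpace I₂ y)]
  [IsManifold I₁ 1 M₁] [IsManifold I₂ 1 M₂]
  [IsContinuousRiemannianBundle E₁ (fun x : M₁ => TangentSpace I₁ x)]
  [IsContinuousRiemannianBundle E₂ (fun y : M₂ => TangentSpace I₂ y)]

/-- Deducing this from the factors avoids proving that the product metric is a continuous bundle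
metric. -/
theorem ContMDiffOn.continuousOn_norm_velocity_prodMk {α : ℝ → M₁} {β : ℝ → M₂}
    (hα : ContMDiffOn 𝓘(ℝ, ℝ) I₁ 1 α (Icc 0 1)) (hβ : ContMDiffOn 𝓘(ℝ, ℝ) I₂ 1 β (Icc 0 1)) :
    ContinuousOn (fun t => ‖velocity (I₁.prod I₂) (fun t => (α t, β t)) t‖) (Icc 0 1) := by
  refine ((hα.continuousOn_norm_velocity.pow 2).add
    (hβ.continuousOn_norm_velocity.pow 2)).sqrt.congr fun t ht => ?_
  rw [← Real.sqrt_sq (norm_nonneg (velocity (I₁.prod I₂) (fun t => (α t, β t)) t)),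
    hα.norm_velocity_prodMk_sq hβ ht]
  rfl

/-- The speeds of two curves, weighted by the distances of their endpoints, integrate to at least
the sum of the squares of these distances. -/
theorem sq_add_sq_le_integral_speeds {α : ℝ → M₁} {β : ℝ → M₂} {x x' : M₁} {y y' : M₂}
    (hα : ContMDiffOn 𝓘(ℝ, ℝ) I₁ 1 α (Icc 0 1)) (hβ : ContMDiffOn 𝓘(ℝ, ℝ) I₂ 1 β (Icc 0 1))
    (hα0 : α 0 = x) (hα1 : α 1 = x') (hβ0 : β 0 = y) (hβ1 : β 1 = y') :
    (riemannianEDist I₁ x x').toReal ^ 2 + (riemannianEDist I₂ y y').toReal ^ 2 ≤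
      ∫ t in Icc (0 : ℝ) 1, ((riemannianEDist I₁ x x').toReal * ‖velocity I₁ α t‖ +
        (riemannianEDist I₂ y y').toReal * ‖velocity I₂ β t‖) := by
  rw [integral_add ((hα.continuousOn_norm_velocity.integrableOn_compact isCompact_Icc).const_mul _)
    ((hβ.continuousOn_norm_velocity.integrableOn_compact isCompact_Icc).const_mul _),
    integral_const_mul, integral_const_mul, sq, sq]
  have h1 := riemannianEDist_toReal_le_integral hα hα0 hα1
  have h2 := riemannianEDist_toReal_le_integral hβ hβ0 hβ1
  gcongr

/-- The length of a curve in a product dominates the product distance of its endpoints. -/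
theorem le_riemannianEDist_prod {x x' : M₁} {y y' : M₂} {c : ℝ} (hc : 0 ≤ c)
    (h : c ^ 2 = (riemannianEDist I₁ x x').toReal ^ 2 + (riemannianEDist I₂ y y').toReal ^ 2) :
    ENNReal.ofReal c ≤ riemannianEDist (I₁.prod I₂) (x, y) (x', y') := by
  refine le_of_forall_gt fun r hr => ?_
  obtain ⟨γ, h0, h1, hγ, hlt⟩ := exists_lt_of_riemannianEDist_lt hr
  obtain ⟨hα, hβ⟩ := contMDiffOn_prodMk_iff (α := fun t => (γ t).1) (β := fun t => (γ t).2) |>.1 hγ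
  refine lt_of_le_of_lt ?_ hlt
  have hcont := hα.continuousOn_norm_velocity_prodMk hβ
  rw [pathELength_eq_ofReal_integral hcont]
  refine ENNReal.ofReal_le_ofReal ?_
  -- The argument below cancels a factor `c`, so `c = 0` is separate.
  rcases hc.eq_or_lt with rfl | hpos
  · exact integral_nonneg fun _ => norm_nonneg _
  have key := sq_add_sq_le_integral_speeds (x := x) (x' := x') (y := y) (y' := y') hα hβ
    (by simp [h0]) (by simp [h1]) (by simp [h0]) (by simp [h1])
  refine le_of_mul_le_mul_left ?_ hpos
  rw [← sq, h]
  refine key.trans ?_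
  rw [← integral_const_mul]
  refine setIntegral_mono_on ?_ ?_ measurableSet_Icc fun t ht => ?_
  · exact ((continuousOn_const.mul hα.continuousOn_norm_velocity).add
      (continuousOn_const.mul hβ.continuousOn_norm_velocity)).integrableOn_compact isCompact_Icc
  · exact (continuousOn_const.mul hcont).integrableOn_compact isCompact_Icc
  · exact mul_add_mul_le_of_sq_add_sq hc (norm_nonneg _) h (hα.norm_velocity_prodMk_sq hβ ht)

/-- Pairs of minimizing geodesics are minimizing geodesics of the product. -/
theorem IsMinimizingGeodesic.prodMk {α : ℝ → M₁} {β : ℝ → M₂} {x x' : M₁} {y y' : M₂}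
    (hα : IsMinimizingGeodesic I₁ α x x') (hβ : IsMinimizingGeodesic I₂ β y y') :
    IsMinimizingGeodesic (I₁.prod I₂) (fun t => (α t, β t)) (x, y) (x', y') := by
  have hα1 := hα.contMDiffOn_one
  have hβ1 := hβ.contMDiffOn_one
  have hz : (0 : ℝ) ∈ Icc (0 : ℝ) 1 := ⟨le_rfl, zero_le_one⟩
  have hspeed : ∀ t ∈ Icc (0 : ℝ) 1, ‖velocity (I₁.prod I₂) (fun t => (α t, β t)) t‖ =
      ‖velocity (I₁.prod I₂) (fun t => (α t, β t)) 0‖ := fun t ht => by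
    rw [← sq_eq_sq₀ (norm_nonneg _) (norm_nonneg _), hα1.norm_velocity_prodMk_sq hβ1 ht,
      hα1.norm_velocity_prodMk_sq hβ1 hz, hα.constant_speed t ht, hβ.constant_speed t ht]
  have hsmooth := contMDiffOn_prodMk_iff.2 ⟨hα.smooth, hβ.smooth⟩
  refine ⟨hsmooth, ?_, ?_, hspeed, le_antisymm ?_ ?_⟩
  · simp [hα.source, hβ.source]
  · simp [hα.target, hβ.target]
  · rw [pathELength_eq_ofReal_integral (continuousOn_const.congr hspeed),
      setIntegral_congr_fun measurableSet_Icc hspeed]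
    simp only [integral_const, measureReal_restrict_apply_univ, Real.volume_real_Icc, sub_zero,
      zero_le_one, sup_of_le_left, one_smul]
    refine le_riemannianEDist_prod (norm_nonneg _) ?_
    rw [hα1.norm_velocity_prodMk_sq hβ1 hz, hα.riemannianEDist_eq, hβ.riemannianEDist_eq,
      ENNReal.toReal_ofReal (norm_nonneg _), ENNReal.toReal_ofReal (norm_nonneg _)]
  · exact riemannianEDist_le_pathELength
      (contMDiffOn_prodMk_iff.2 ⟨hα1, hβ1⟩)
      (by simp [hα.source, hβ.source]) (by simp [hα.target, hβ.target]) zero_le_one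

/-- If `x, x'` and `y, y'` are joined by minimizing geodesics, then the components of a minimizing
geodesic of the product from `(x, y)` to `(x', y')` are minimizing geodesics. -/
theorem IsMinimizingGeodesic.of_prodMk {α α₀ : ℝ → M₁} {β β₀ : ℝ → M₂} {x x' : M₁} {y y' : M₂}
    (hα₀ : IsMinimizingGeodesic I₁ α₀ x x') (hβ₀ : IsMinimizingGeodesic I₂ β₀ y y')
    (h : IsMinimizingGeodesic (I₁.prod I₂) (fun t => (α t, β t)) (x, y) (x', y')) :
    IsMinimizingGeodesic I₁ α x x' ∧ IsMinimizingGeodesic I₂ β y y' := by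
  obtain ⟨hα, hβ⟩ := contMDiffOn_prodMk_iff.1 h.smooth
  obtain ⟨hα1, hβ1⟩ := contMDiffOn_prodMk_iff.1 h.contMDiffOn_one
  have hz : (0 : ℝ) ∈ Icc (0 : ℝ) 1 := ⟨le_rfl, zero_le_one⟩
  obtain ⟨s1, s2⟩ := Prod.ext_iff.1 h.source
  obtain ⟨t1, t2⟩ := Prod.ext_iff.1 h.target
  set a := (riemannianEDist I₁ x x').toReal with ha
  set b := (riemannianEDist I₂ y y').toReal with hb
  set c := ‖velocity (I₁.prod I₂) (fun t => (α t, β t)) 0‖ with hcdef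
  -- The reference geodesic `α₀` guarantees that the distance is finite.
  have hEa : riemannianEDist I₁ x x' = ENNReal.ofReal a := by
    rw [ha, hα₀.riemannianEDist_eq, ENNReal.toReal_ofReal (norm_nonneg _)]
  have hEb : riemannianEDist I₂ y y' = ENNReal.ofReal b := by
    rw [hb, hβ₀.riemannianEDist_eq, ENNReal.toReal_ofReal (norm_nonneg _)]
  -- The given geodesic and the pair `(α₀, β₀)` have the same speed, namely the product distance.
  have hc : c ^ 2 = a ^ 2 + b ^ 2 := by
    have h1 := (hα₀.prodMk hβ₀).riemannianEDist_eq
    rw [h.riemannianEDist_eq, ENNReal.ofReal_eq_ofReal_iff (norm_nonneg _) (norm_nonneg _)] at h1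
    rw [hcdef, h1, hα₀.contMDiffOn_one.norm_velocity_prodMk_sq hβ₀.contMDiffOn_one hz,
      ha, hb, hα₀.riemannianEDist_eq, hβ₀.riemannianEDist_eq,
      ENNReal.toReal_ofReal (norm_nonneg _), ENNReal.toReal_ofReal (norm_nonneg _)]
  have hsq : ∀ t ∈ Icc (0 : ℝ) 1, ‖velocity I₁ α t‖ ^ 2 + ‖velocity I₂ β t‖ ^ 2 = c ^ 2 :=
    fun t ht => by rw [← hα1.norm_velocity_prodMk_sq hβ1 ht, h.constant_speed t ht]
  -- The equality case: the integrand is at most `c²` while its integral is at least `c²`.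
  have hlin : ∀ t ∈ Icc (0 : ℝ) 1, a * ‖velocity I₁ α t‖ + b * ‖velocity I₂ β t‖ = c ^ 2 := by
    refine eqOn_const_of_le_integral ((continuousOn_const.mul hα1.continuousOn_norm_velocity).add
      (continuousOn_const.mul hβ1.continuousOn_norm_velocity)) (fun t ht => ?_) ?_
    · rw [sq]
      exact mul_add_mul_le_of_sq_add_sq (norm_nonneg _) (norm_nonneg _) hc (hsq t ht).symm
    · rw [hc]
      exact sq_add_sq_le_integral_speeds hα1 hβ1 s1 t1 s2 t2
  -- With speeds `f`, `g`: `(f - a)² + (g - b)² = c² - 2c² + c² = 0`.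
  have hspeed : ∀ t ∈ Icc (0 : ℝ) 1, ‖velocity I₁ α t‖ = a ∧ ‖velocity I₂ β t‖ = b := by
    intro t ht
    have h1 := hsq t ht
    have h2 := hlin t ht
    constructor
    · refine sub_eq_zero.1 (pow_eq_zero_iff two_ne_zero |>.1 (le_antisymm ?_ (sq_nonneg _)))
      nlinarith [sq_nonneg (‖velocity I₂ β t‖ - b)]
    · refine sub_eq_zero.1 (pow_eq_zero_iff two_ne_zero |>.1 (le_antisymm ?_ (sq_nonneg _)))
      nlinarith [sq_nonneg (‖velocity I₁ α t‖ - a)]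
  refine ⟨⟨hα, s1, t1, fun t ht => by rw [(hspeed t ht).1, (hspeed 0 hz).1], ?_⟩,
    ⟨hβ, s2, t2, fun t ht => by rw [(hspeed t ht).2, (hspeed 0 hz).2], ?_⟩⟩
  · rw [pathELength_eq_ofReal_integral hα1.continuousOn_norm_velocity,
      setIntegral_congr_fun measurableSet_Icc fun t ht => (hspeed t ht).1, hEa]
    simp
  · rw [pathELength_eq_ofReal_integral hβ1.continuousOn_norm_velocity,
      setIntegral_congr_fun measurableSet_Icc fun t ht => (hspeed t ht).2, hEb]
    simp

end ProductGeodesics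

/-! ### Splitting of the logarithm and decoupling. -/

section Logarithm

theorem IsGeodesicallyConvex.exists_isMinimizingGeodesic
    {E : Type*} [NormedAddCommGroup E] [NormedSpace ℝ E]
    {H : Type*} [TopologicalSpace H] {I : ModelWithCorners ℝ E H}
    {M : Type*} [TopologicalSpace M] [ChartedSpace H M]
    [RiemannianBundle (fun x : M => TangentSpace I x)]
    {U : Set M} (hU : IsGeodesicallyConvex I U) {x y : M} (hx : x ∈ U) (hy : y ∈ U) :
    ∃ γ : ℝ → M, IsMinimizingGeodesic I γ x y :=
  (hU x hx y hy).imp fun _ h => h.1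

/-- In a geodesically convex set the logarithm is the initial velocity of any minimizing
geodesic. -/
theorem IsGeodesicallyConvex.riemannianLog_eq
    {E : Type*} [NormedAddCommGroup E] [NormedSpace ℝ E]
    {H : Type*} [TopologicalSpace H] {I : ModelWithCorners ℝ E H}
    {M : Type*} [TopologicalSpace M] [ChartedSpace H M]
    [RiemannianBundle (fun x : M => TangentSpace I x)]
    {U : Set M} (hU : IsGeodesicallyConvex I U) {x y : M} (hx : x ∈ U) (hy : y ∈ U)
    {γ : ℝ → M} (hγ : IsMinimizingGeodesic I γ x y) :
    (show E from riemannianLog I x y) = (show E from velocity I γ 0) := by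
  have h : ∃ γ : ℝ → M, IsMinimizingGeodesic I γ x y := ⟨γ, hγ⟩
  have h1 : (show E from riemannianLog I x y) = (show E from velocity I h.choose 0) := dif_pos h
  obtain ⟨η, -, -, huniq⟩ := hU x hx y hy
  rw [h1]
  exact velocity_congr ((huniq _ h.choose_spec).trans (huniq _ hγ).symm) ⟨le_rfl, zero_le_one⟩

variable {E₁ : Type*} [NormedAddCommGroup E₁] [NormedSpace ℝ E₁]
  {H₁ : Type*} [TopologicalSpace H₁] {I₁ : ModelWithCorners ℝ E₁ H₁}
  {M₁ : Type*} [TopologicalSpace M₁] [ChartedSpace H₁ M₁]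
  {E₂ : Type*} [NormedAddCommGroup E₂] [NormedSpace ℝ E₂]
  {H₂ : Type*} [TopologicalSpace H₂] {I₂ : ModelWithCorners ℝ E₂ H₂}
  {M₂ : Type*} [TopologicalSpace M₂] [ChartedSpace H₂ M₂]
  [RiemannianBundle (fun x : M₁ => TangentSpace I₁ x)]
  [RiemannianBundle (fun y : M₂ => TangentSpace I₂ y)]
  [IsManifold I₁ 1 M₁] [IsManifold I₂ 1 M₂]
  [IsContinuousRiemannianBundle E₁ (fun x : M₁ => TangentSpace I₁ x)]
  [IsContinuousRiemannianBundle E₂ (fun y : M₂ => TangentSpace I₂ y)]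

/-- The logarithm of the product metric is the pair of the logarithms of the factors. -/
theorem IsGeodesicallyConvex.riemannianLog_prod {U₁ : Set M₁} {U₂ : Set M₂}
    (hU₁ : IsGeodesicallyConvex I₁ U₁) (hU₂ : IsGeodesicallyConvex I₂ U₂)
    {x x' : M₁} (hx : x ∈ U₁) (hx' : x' ∈ U₁) {y y' : M₂} (hy : y ∈ U₂) (hy' : y' ∈ U₂) :
    (show E₁ × E₂ from riemannianLog (I₁.prod I₂) (x, y) (x', y')) =
      (show E₁ from riemannianLog I₁ x x', show E₂ from riemannianLog I₂ y y') := by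
  obtain ⟨α₀, hα₀⟩ := hU₁.exists_isMinimizingGeodesic hx hx'
  obtain ⟨β₀, hβ₀⟩ := hU₂.exists_isMinimizingGeodesic hy hy'
  have h : ∃ γ : ℝ → M₁ × M₂, IsMinimizingGeodesic (I₁.prod I₂) γ (x, y) (x', y') :=
    ⟨_, hα₀.prodMk hβ₀⟩
  have h1 : (show E₁ × E₂ from riemannianLog (I₁.prod I₂) (x, y) (x', y')) =
    (show E₁ × E₂ from velocity (I₁.prod I₂) h.choose 0) := dif_pos h
  -- Whichever product geodesic was selected, its components are minimizing, so convexity of the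
  -- factors fixes its initial velocity; uniqueness in the product is not needed.
  obtain ⟨hα, hβ⟩ := IsMinimizingGeodesic.of_prodMk (α := fun t => (h.choose t).1)
    (β := fun t => (h.choose t).2) hα₀ hβ₀ h.choose_spec
  have hz : (0 : ℝ) ∈ Icc (0 : ℝ) 1 := ⟨le_rfl, zero_le_one⟩
  rw [h1, hU₁.riemannianLog_eq hx hx' hα, hU₂.riemannianLog_eq hy hy' hβ]
  exact velocity_prodMk hz (hα.contMDiffOn_one.mdifferentiableOn one_ne_zero 0 hz)
    (hβ.contMDiffOn_one.mdifferentiableOn one_ne_zero 0 hz)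

/-- The discrete model on a product of geodesically convex sets decouples. -/
theorem isDiscreteSolution_prodMk_iff {U₁ : Set M₁} {U₂ : Set M₂}
    (hU₁ : IsGeodesicallyConvex I₁ U₁) (hU₂ : IsGeodesicallyConvex I₂ U₂)
    {n : ℕ} {T : EReal} {x₀ : Fin n → M₁} {y₀ : Fin n → M₂}
    {x : Fin n → ℝ → M₁} {y : Fin n → ℝ → M₂} :
    IsDiscreteSolution (I₁.prod I₂) (U₁ ×ˢ U₂) T
        (fun i => (x₀ i, y₀ i)) (fun i t => (x i t, y i t)) ↔
      IsDiscreteSolution I₁ U₁ T x₀ x ∧ IsDiscreteSolution I₂ U₂ T y₀ y := by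
  -- All points at time `t` must lie in the convex sets, since only there is the logarithm known to
  -- split.
  have hrhs : ∀ t, (∀ i, x i t ∈ U₁) → (∀ i, y i t ∈ U₂) → ∀ i,
      (show E₁ × E₂ from (1 / (n : ℝ)) •
        ∑ j, riemannianLog (I₁.prod I₂) (x i t, y i t) (x j t, y j t)) =
      (show E₁ from (1 / (n : ℝ)) • ∑ j, riemannianLog I₁ (x i t) (x j t),
        show E₂ from (1 / (n : ℝ)) • ∑ j, riemannianLog I₂ (y i t) (y j t)) := by
    intro t hx hy i
    have h : (∑ j, (show E₁ × E₂ from riemannianLog (I₁.prod I₂) (x i t, y i t) (x j t, y j t))) =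
        (∑ j, (show E₁ from riemannianLog I₁ (x i t) (x j t)),
          ∑ j, (show E₂ from riemannianLog I₂ (y i t) (y j t))) := by
      rw [Finset.sum_congr rfl fun j _ =>
        hU₁.riemannianLog_prod hU₂ (hx i) (hx j) (hy i) (hy j), prod_mk_sum]
    exact congrArg (fun v : E₁ × E₂ => (1 / (n : ℝ)) • v) h
  have hderiv : ∀ t, (∀ i, x i t ∈ U₁) → (∀ i, y i t ∈ U₂) → ∀ i,
      (HasMFDerivWithinAt 𝓘(ℝ, ℝ) (I₁.prod I₂) (fun t => (x i t, y i t)) (timeInterval T) t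
        ((1 : ℝ →L[ℝ] ℝ).smulRight (show E₁ × E₂ from (1 / (n : ℝ)) •
          ∑ j, riemannianLog (I₁.prod I₂) (x i t, y i t) (x j t, y j t))) ↔
      HasMFDerivWithinAt 𝓘(ℝ, ℝ) I₁ (x i) (timeInterval T) t
        ((1 : ℝ →L[ℝ] ℝ).smulRight (show E₁ from (1 / (n : ℝ)) •
          ∑ j, riemannianLog I₁ (x i t) (x j t))) ∧
      HasMFDerivWithinAt 𝓘(ℝ, ℝ) I₂ (y i) (timeInterval T) t
        ((1 : ℝ →L[ℝ] ℝ).smulRight (show E₂ from (1 / (n : ℝ)) •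
          ∑ j, riemannianLog I₂ (y i t) (y j t)))) := by
    intro t hx hy i
    rw [hrhs t hx hy i]
    exact hasMFDerivWithinAt_prodMk_iff
  constructor
  · intro h
    have hx : ∀ i, ∀ t ∈ timeInterval T, x i t ∈ U₁ := fun i t ht => (h.mem i t ht).1
    have hy : ∀ i, ∀ t ∈ timeInterval T, y i t ∈ U₂ := fun i t ht => (h.mem i t ht).2
    have hd := fun i t ht =>
      (hderiv t (fun i => hx i t ht) (fun i => hy i t ht) i).1 (h.deriv i t ht)
    exact ⟨⟨hx, fun i => (Prod.ext_iff.1 (h.initial i)).1, fun i t ht => (hd i t ht).1⟩,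
      ⟨hy, fun i => (Prod.ext_iff.1 (h.initial i)).2, fun i t ht => (hd i t ht).2⟩⟩
  · rintro ⟨h1, h2⟩
    exact ⟨fun i t ht => ⟨h1.mem i t ht, h2.mem i t ht⟩,
      fun i => Prod.ext (h1.initial i) (h2.initial i),
      fun i t ht => (hderiv t (fun i => h1.mem i t ht) (fun i => h2.mem i t ht) i).2
        ⟨h1.deriv i t ht, h2.deriv i t ht⟩⟩

theorem IsUniqueGlobalSolution.prodMk {U₁ : Set M₁} {U₂ : Set M₂}
    (hU₁ : IsGeodesicallyConvex I₁ U₁) (hU₂ : IsGeodesicallyConvex I₂ U₂)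
    {n : ℕ} {x₀ : Fin n → M₁} {y₀ : Fin n → M₂} {x : Fin n → ℝ → M₁} {y : Fin n → ℝ → M₂}
    (hx : IsUniqueGlobalSolution I₁ U₁ x₀ x) (hy : IsUniqueGlobalSolution I₂ U₂ y₀ y) :
    IsUniqueGlobalSolution (I₁.prod I₂) (U₁ ×ˢ U₂)
      (fun i => (x₀ i, y₀ i)) (fun i t => (x i t, y i t)) := by
  refine ⟨(isDiscreteSolution_prodMk_iff hU₁ hU₂).2 ⟨hx.1, hy.1⟩, fun z hz i t ht => ?_⟩
  -- Any competitor `z` is the pair of its components, so decoupling applies to it too.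
  obtain ⟨h1, h2⟩ := (isDiscreteSolution_prodMk_iff (x := fun i t => (z i t).1)
    (y := fun i t => (z i t).2) hU₁ hU₂).1 hz
  exact Prod.ext (hx.2 _ h1 i t ht) (hy.2 _ h2 i t ht)

end Logarithm

/-- A smoothly varying metric varies continuously. -/
theorem IsContMDiffRiemannianBundle.isContinuousRiemannianBundle_tangentSpace
    {E : Type*} [NormedAddCommGroup E] [NormedSpace ℝ E]
    {H : Type*} [TopologicalSpace H] {I : ModelWithCorners ℝ E H}
    {M : Type*} [TopologicalSpace M] [ChartedSpace H M] [IsManifold I 1 M]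
    [RiemannianBundle (fun x : M => TangentSpace I x)] {n : ℕ∞ω}
    (h : IsContMDiffRiemannianBundle I n E (fun x : M => TangentSpace I x)) :
    IsContinuousRiemannianBundle E (fun x : M => TangentSpace I x) := by
  obtain ⟨g, hg, hg'⟩ := h.exists_contMDiff
  exact ⟨g, hg.continuous, hg'⟩

theorem tendsto_productDist {M₁ M₂ : Type*} [Dist M₁] [Dist M₂] {ι : Type*} {l : Filter ι}
    {x x' : ι → M₁} {y y' : ι → M₂} (hx : Tendsto (fun t => dist (x t) (x' t)) l (𝓝 0))
    (hy : Tendsto (fun t => dist (y t) (y' t)) l (𝓝 0)) :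
    Tendsto (fun t => productDist (x t, y t) (x' t, y' t)) l (𝓝 0) := by
  simpa [productDist] using ((hx.pow 2).add (hy.pow 2)).sqrt

theorem mainTheorem11
    {k₁ k₂ : ℕ}
    {M₁ : Type*} [MetricSpace M₁] [ChartedSpace (EuclideanSpace ℝ (Fin k₁)) M₁]
    [IsManifold (𝓡 k₁) ∞ M₁]
    [RiemannianBundle (fun x : M₁ => TangentSpace (𝓡 k₁) x)]
    [IsContMDiffRiemannianBundle (𝓡 k₁) ∞ (EuclideanSpace ℝ (Fin k₁))
      (fun x : M₁ => TangentSpace (𝓡 k₁) x)]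
    [IsRiemannianManifold (𝓡 k₁) M₁] [CompleteSpace M₁] [ConnectedSpace M₁]
    {M₂ : Type*} [MetricSpace M₂] [ChartedSpace (EuclideanSpace ℝ (Fin k₂)) M₂]
    [IsManifold (𝓡 k₂) ∞ M₂]
    [RiemannianBundle (fun y : M₂ => TangentSpace (𝓡 k₂) y)]
    [IsContMDiffRiemannianBundle (𝓡 k₂) ∞ (EuclideanSpace ℝ (Fin k₂))
      (fun y : M₂ => TangentSpace (𝓡 k₂) y)]
    [IsRiemannianManifold (𝓡 k₂) M₂] [CompleteSpace M₂] [ConnectedSpace M₂]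
    (U₁ : Set M₁) (hU₁ : IsOpen U₁) (hU₁c : IsGeodesicallyConvex (𝓡 k₁) U₁)
    (U₂ : Set M₂) (hU₂ : IsOpen U₂) (hU₂c : IsGeodesicallyConvex (𝓡 k₂) U₂)
    (n : ℕ) (x₀ : Fin n → M₁) (y₀ : Fin n → M₂) :
    (∀ T : EReal, 0 < T → ∀ (x : Fin n → ℝ → M₁) (y : Fin n → ℝ → M₂),
      IsDiscreteSolution ((𝓡 k₁).prod (𝓡 k₂)) (U₁ ×ˢ U₂) T
          (fun i => (x₀ i, y₀ i)) (fun i t => (x i t, y i t)) ↔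
        IsDiscreteSolution (𝓡 k₁) U₁ T x₀ x ∧ IsDiscreteSolution (𝓡 k₂) U₂ T y₀ y) ∧
    (∀ (x : Fin n → ℝ → M₁) (y : Fin n → ℝ → M₂),
      IsUniqueGlobalSolution (𝓡 k₁) U₁ x₀ x →
      IsUniqueGlobalSolution (𝓡 k₂) U₂ y₀ y →
      (∀ i j, Tendsto (fun t => dist (x i t) (x j t)) atTop (𝓝 0)) →
      (∀ i j, Tendsto (fun t => dist (y i t) (y j t)) atTop (𝓝 0)) →
      IsUniqueGlobalSolution ((𝓡 k₁).prod (𝓡 k₂)) (U₁ ×ˢ U₂)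
          (fun i => (x₀ i, y₀ i)) (fun i t => (x i t, y i t)) ∧
        ∀ i j, Tendsto (fun t => productDist (x i t, y i t) (x j t, y j t)) atTop (𝓝 0)) := by
  have hM₁ : IsManifold (𝓡 k₁) 1 M₁ := .of_le (n := ∞) (by exact_mod_cast le_top)
  have hM₂ : IsManifold (𝓡 k₂) 1 M₂ := .of_le (n := ∞) (by exact_mod_cast le_top)
  have hB₁ : IsContinuousRiemannianBundle (EuclideanSpace ℝ (Fin k₁))
      (fun x : M₁ => TangentSpace (𝓡 k₁) x) :=
    IsContMDiffRiemannianBundle.isContinuousRiemannianBundle_tangentSpace (n := ∞) inferInstance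
  have hB₂ : IsContinuousRiemannianBundle (EuclideanSpace ℝ (Fin k₂))
      (fun y : M₂ => TangentSpace (𝓡 k₂) y) :=
    IsContMDiffRiemannianBundle.isContinuousRiemannianBundle_tangentSpace (n := ∞) inferInstance
  exact ⟨fun _ _ _ _ => isDiscreteSolution_prodMk_iff hU₁c hU₂c, fun _ _ hx hy hdx hdy =>
    ⟨hx.prodMk hU₁c hU₂c hy, fun i j => tendsto_productDist (hdx i j) (hdy i j)⟩⟩
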